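/- Let $X$ be a real Hilbert space, let $S\subseteq X$ be nonempty, and let $T\colon S\to X$ be nonexpansive, i.e., $\|Tx-Ty\|\le\|x-y\|$ for all $x,y\in S$. Construct a set-valued operator $\widetilde T$ on $X$ as follows. 1. Set $F:=\tfrac12\mathrm{Id}+\tfrac12T\colon S\to X$. 2. Set $A:=F^{-1}-\mathrm{Id}$, a set-valued operator on $X$ with graph $\operatorname{gra}A=\{(Fs,\,s-Fs) : s\in S\}$. 3. Let $\Phi_A(x,x^*)=\sup_{(a,a^*)\in\operatorname{gra}A}\big(\langle x,a^*\rangle+\langle a,x^*\rangle-\langle a,a^*\rangle\big)$ be the Fitzpatrick function of $A$, with Fenchel conjugate $\Phi_A^*(y^*,y)=\sup_{(x,x^*)\in X\times X}\big(\langle x,y^*\rangle+\langle y,x^*\rangle-\Phi_A(x,x^*)\big)$, and let $$\Psi_A(x,x^*)=\inf_{(x,x^*)=\frac12(y+z,\,y^*+z^*)}\Big(\tfrac12\Phi_A(y,y^*)+\tfrac12\Phi_A^*(z^*,z)+\tfrac18\big(\|y-z\|^2+\|y^*-z^*\|^2\big)\Big).$$ Define the set-valued operator $\widetilde A$ on $X$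 by $x^*\in\widetilde Ax$ if and only if $(x^*,x)\in\partial\Psi_A(x,x^*)$, where $\partial$ is the subdifferential of convex analysis. 4. Set $\widetilde F:=(\mathrm{Id}+\widetilde A)^{-1}$. 5. Set $\widetilde T:=2\widetilde F-\mathrm{Id}$. Let $D:=\overline{\operatorname{conv}}\,\operatorname{ran}T$ and let $P$ be the orthogonal (nearest-point) projector onto $D$. Then $\widetilde T$ and $P$ are single-valued and defined on all of $X$, $\widetilde T\colon X\to X$ is a nonexpansive extension of $T$, and $P\widetilde T\colon X\to X$ is a nonexpansive extension of $T$ such that $\overline{\operatorname{ran}}(P\widetilde T)\subseteq D$. -/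

import Mathlib

namespace KV

noncomputable section

/-! A set-valued operator on `X` is a map `A : X → Set X`; its graph is the set of pairs
`(x, u)` with `u ∈ A x`. Extended-real-valued functions are `EReal`-valued. -/

/-- The set-valued operator on `X` whose graph is the graph of `F : S → X`. -/
def ofMap {X : Type*} {S : Set X} (F : S → X) : X → Set X :=
  fun x => {u | ∃ h : x ∈ S, F ⟨x, h⟩ = u}

/-- The inverse of a set-valued operator. -/
def inv {X : Type*} (A : X → Set X) : X → Set X :=
  fun u => {x | u ∈ A x}

variable {X : Type*} [NormedAddCommGroup X] [InnerProductSpace ℝ X]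

/-- The graph of a set-valued operator. -/
def gra (A : X → Set X) : Set (X × X) := {p | p.2 ∈ A p.1}

/-- The operator `Id + A`. -/
def idAdd (A : X → Set X) : X → Set X := fun x => (fun u => x + u) '' A x

/-- The operator `A - Id`. -/
def subId (A : X → Set X) : X → Set X := fun x => (fun u => u - x) '' A x

/-- The operator `2 A - Id`. -/
def twoSubId (A : X → Set X) : X → Set X := fun x => (fun u => (2 : ℝ) • u - x) '' A x

/-- The duality pairing `⟨(x, y), (u, v)⟩ = ⟨x, u⟩ + ⟨y, v⟩` of the Hilbert space `X × X`. -/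
def pairing (p q : X × X) : ℝ := inner ℝ p.1 q.1 + inner ℝ p.2 q.2

/-- The Fitzpatrick function of `A`:
`Φ_A (x, u) = sup {⟨x, b⟩ + ⟨a, u⟩ - ⟨a, b⟩ | (a, b) ∈ gra A}`. -/
def fitzpatrick (A : X → Set X) (p : X × X) : EReal :=
  ⨆ a ∈ gra A, ((inner ℝ p.1 a.2 + inner ℝ a.1 p.2 - inner ℝ a.1 a.2 : ℝ) : EReal)

/-- The Fenchel conjugate of a function on `X × X`. -/
def conjugate (f : X × X → EReal) (q : X × X) : EReal :=
  ⨆ p : X × X, (((pairing p q : ℝ) : EReal) - f p)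

/-- The subdifferential of a function on `X × X` (for proper functions: where the function is
`⊤`, no subgradient exists). -/
def subdifferential (f : X × X → EReal) (p : X × X) : Set (X × X) :=
  {q | ∀ r : X × X, f p + ((pairing (r - p) q : ℝ) : EReal) ≤ f r}

/-- The proximal average of `Φ_A` and the transpose of `Φ_A^*`: the value at `p` is the infimum of
`½ Φ_A (y, y') + ½ Φ_A^* (z', z) + ⅛ (‖y - z‖² + ‖y' - z'‖²)` over all pairs `(y, y')`, `(z, z')`
whose midpoint is `p`. -/
def proximalAverage (A : X → Set X) (p : X × X) : EReal :=
  ⨅ (y : X × X) (z : X × X) (_ : p = (1 / 2 : ℝ) • (y + z)),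
    ((1 / 2 : ℝ) : EReal) * fitzpatrick A y
      + ((1 / 2 : ℝ) : EReal) * conjugate (fitzpatrick A) (z.2, z.1)
      + ((1 / 8 * (‖y.1 - z.1‖ ^ 2 + ‖y.2 - z.2‖ ^ 2) : ℝ) : EReal)

/-- The operator `Ã`: `u ∈ Ã x` if and only if `(u, x) ∈ ∂Ψ_A (x, u)`, where `Ψ_A` is the
proximal average above. -/
def tildeOp (A : X → Set X) : X → Set X :=
  fun x => {u | (u, x) ∈ subdifferential (proximalAverage A) (x, u)}

/-- `F = ½ Id + ½ T` on `S`. -/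
def halfMap {S : Set X} (T : S → X) : S → X :=
  fun s => (1 / 2 : ℝ) • (s : X) + (1 / 2 : ℝ) • T s

/-- `A = F⁻¹ - Id` with `F = ½ Id + ½ T`. -/
def associatedOp {S : Set X} (T : S → X) : X → Set X :=
  subId (inv (ofMap (halfMap T)))

/-- `F̃ = (Id + Ã)⁻¹`. -/
def tildeF {S : Set X} (T : S → X) : X → Set X :=
  inv (idAdd (tildeOp (associatedOp T)))

/-- `T̃ = 2 F̃ - Id`, as a set-valued operator. -/
def tildeT {S : Set X} (T : S → X) : X → Set X :=
  twoSubId (tildeF T)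

/-- The projector onto `D`, as a set-valued operator: all points of `D` nearest to `x`. -/
def projector (D : Set X) : X → Set X :=
  fun x => {p | p ∈ D ∧ ∀ q ∈ D, ‖x - p‖ ≤ ‖x - q‖}

end

end KV

/-! Write `J (x, u) = (u, x)`, `Φ` for the Fitzpatrick function of the monotone operator `A`, and
`Ψ` for the proximal average. The subgradient inequality for `Ψ`, used at two points of the graph
of `Ã`, shows that `Ã` is monotone (`IsMonotone.tildeOp`), so that its resolvent `F̃` is firmly
nonexpansive and `T̃ = 2 F̃ - Id` is nonexpansive. What has to be shown is that `Id + Ã` is onto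
and that `Ã` extends `A`.

Both come from one computation (`swap_subgradient_proximalAverage`). Let `v = (w, w)` and suppose
that `v - y` is a subgradient of `Φ` at `y`. Put `z = J (v - y)`. As `J v = v`, conjugacy makes
`v - z` a subgradient of `Φ^* ∘ J` at `z`, and the quadratic term in the definition of `Ψ` is such
that the two inequalities average to say that `v - p` is a subgradient of `Ψ` at the midpoint
`p = (y + z) / 2`. But the two components of `p` add up to `w`, so `v - p = J p`, and thus `p` lies
in the graph of `Ã`.

* Every `w` is reached, as a point `y` with `v - y ∈ ∂Φ y` exists: it is the minimizer of
  `Φ + ‖· - v‖² / 2`, found by the parallelogram law on the epigraph of `Φ`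
  (`exists_prox_of_isClosed_convex`, `IsMonotone.exists_prox_fitzpatrick`).
* If `a` is in the graph of `A`, then `J a ∈ ∂Φ a`, so `y = a` is admissible for `w = a.1 + a.2`,
  and then `p = a`; thus `Ã` extends `A`.

Finally the projector onto a closed convex set is nonexpansive and fixes the points of that set,
among them the values of `T`.
-/

namespace KV

/-! ### Proximal points and projections in a Hilbert space -/

section Hilbert

variable {H : Type*} [NormedAddCommGroup H] [InnerProductSpace ℝ H]

/-- A point of a convex set `C ⊆ H × ℝ` (thought of as an epigraph) minimizing
`t + ‖y - v‖² / 2` comes with the subgradient `v - y`. -/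
theorem subgradient_of_isMinOn {C : Set (H × ℝ)} (hconv : Convex ℝ C) {v : H} {c : H × ℝ}
    (hc : c ∈ C) (hmin : ∀ d ∈ C, c.2 + ‖c.1 - v‖ ^ 2 / 2 ≤ d.2 + ‖d.1 - v‖ ^ 2 / 2)
    {d : H × ℝ} (hd : d ∈ C) : c.2 + inner ℝ (d.1 - c.1) (v - c.1) ≤ d.2 := by
  have key : ∀ l : ℝ, 0 < l → l ≤ 1 →
      c.2 + inner ℝ (d.1 - c.1) (v - c.1) - d.2 ≤ l * (‖d.1 - c.1‖ ^ 2 / 2) := by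
    intro l hl hl1
    have hm := hmin _ (hconv hc hd (sub_nonneg.2 hl1) hl.le (by ring))
    have he : ((1 - l) • c + l • d).1 - v = (c.1 - v) + l • (d.1 - c.1) := by
      simp only [Prod.fst_add, Prod.smul_fst]
      module
    have hi : inner ℝ (d.1 - c.1) (v - c.1) = - inner ℝ (c.1 - v) (d.1 - c.1) := by
      rw [← neg_sub c.1 v, inner_neg_right, real_inner_comm]
    rw [he, norm_add_sq_real, inner_smul_right, norm_smul, mul_pow, Real.norm_eq_abs, sq_abs] at hm
    simp only [Prod.snd_add, Prod.smul_snd, smul_eq_mul] at hm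
    rw [hi]
    refine le_of_mul_le_mul_left ?_ hl
    linarith
  have hlim : Filter.Tendsto (fun l : ℝ => l * (‖d.1 - c.1‖ ^ 2 / 2))
      (nhdsWithin 0 (Set.Ioi 0)) (nhds 0) := by
    have : Filter.Tendsto (fun l : ℝ => l * (‖d.1 - c.1‖ ^ 2 / 2)) (nhds 0)
        (nhds (0 * (‖d.1 - c.1‖ ^ 2 / 2))) := by
      exact (continuous_id.mul continuous_const).tendsto 0
    rw [zero_mul] at this
    exact this.mono_left nhdsWithin_le_nhds
  have hle := ge_of_tendsto hlim
    (Filter.eventually_of_mem (Ioc_mem_nhdsGT one_pos) fun l hl => key l hl.1 hl.2)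
  linarith

/-- Existence of proximal points: a closed convex set `C ⊆ H × ℝ` lying above the graph of the
affine function `⟨·, b⟩ - k` contains a point `(y, t)` at which `v - y` is a subgradient. -/
theorem exists_prox_of_isClosed_convex [CompleteSpace H] {C : Set (H × ℝ)} (hclosed : IsClosed C)
    (hconv : Convex ℝ C) (hne : C.Nonempty) {b : H} {k : ℝ}
    (hbound : ∀ c ∈ C, inner ℝ c.1 b - k ≤ c.2) (v : H) :
    ∃ c ∈ C, ∀ d ∈ C, c.2 + inner ℝ (d.1 - c.1) (v - c.1) ≤ d.2 := by
  let φ : H × ℝ → ℝ := fun c => c.2 + ‖c.1 - v‖ ^ 2 / 2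
  have hbdd : BddBelow (φ '' C) := by
    refine ⟨inner ℝ v b - k - ‖b‖ ^ 2 / 2, ?_⟩
    rintro _ ⟨c, hc, rfl⟩
    have h1 := hbound c hc
    have h2 : 0 ≤ ‖(c.1 - v) + b‖ ^ 2 := sq_nonneg _
    rw [norm_add_sq_real, inner_sub_left] at h2
    change _ ≤ c.2 + ‖c.1 - v‖ ^ 2 / 2
    linarith
  set m := sInf (φ '' C)
  have hm : ∀ c ∈ C, m ≤ φ c := fun c hc => csInf_le hbdd ⟨c, hc, rfl⟩
  have hseq : ∀ n : ℕ, ∃ c ∈ C, φ c < m + 1 / ((n : ℝ) + 1) := by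
    intro n
    obtain ⟨_, ⟨c, hc, rfl⟩, hlt⟩ := exists_lt_of_csInf_lt (hne.image φ)
      (lt_add_of_pos_right m (by positivity : (0 : ℝ) < 1 / ((n : ℝ) + 1)))
    exact ⟨c, hc, hlt⟩
  choose c hcC hcm using hseq
  have hmid : ∀ d ∈ C, ∀ e ∈ C, ‖d.1 - e.1‖ ^ 2 ≤ 4 * ((φ d - m) + (φ e - m)) := by
    intro d hd e he
    have h1 := hm _ (hconv hd he (by norm_num : (0 : ℝ) ≤ 1 / 2) (by norm_num : (0 : ℝ) ≤ 1 / 2)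
      (by norm_num))
    have h2 := parallelogram_law_with_norm ℝ (d.1 - v) (e.1 - v)
    have h3 : ((1 / 2 : ℝ) • d + (1 / 2 : ℝ) • e).1 - v
        = (1 / 2 : ℝ) • ((d.1 - v) + (e.1 - v)) := by
      simp only [Prod.fst_add, Prod.smul_fst]
      module
    rw [sub_sub_sub_cancel_right] at h2
    simp only [φ] at h1 ⊢
    rw [h3, norm_smul, mul_pow] at h1
    simp only [Prod.snd_add, Prod.smul_snd, smul_eq_mul] at h1
    norm_num at h1
    nlinarith
  have hlim0 : Filter.Tendsto (fun n : ℕ => 1 / ((n : ℝ) + 1)) Filter.atTop (nhds 0) :=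
    tendsto_one_div_add_atTop_nhds_zero_nat
  have hcauchy : CauchySeq fun n => (c n).1 := by
    refine cauchySeq_of_le_tendsto_0 (fun n : ℕ => √(8 * (1 / ((n : ℝ) + 1)))) ?_ ?_
    · intro i j N hi hj
      have hmono : ∀ {i : ℕ}, N ≤ i → 1 / ((i : ℝ) + 1) ≤ 1 / ((N : ℝ) + 1) := by
        intro i hi
        gcongr
      rw [dist_eq_norm]
      refine Real.le_sqrt_of_sq_le ?_
      linarith [hmid _ (hcC i) _ (hcC j), hcm i, hcm j, hmono hi, hmono hj]
    · have := (Real.continuous_sqrt.tendsto _).comp (hlim0.const_mul 8)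
      rwa [mul_zero, Real.sqrt_zero] at this
  obtain ⟨y, hy⟩ := cauchySeq_tendsto_of_complete hcauchy
  have hφ : Filter.Tendsto (fun n => φ (c n)) Filter.atTop (nhds m) := by
    refine tendsto_of_tendsto_of_tendsto_of_le_of_le tendsto_const_nhds
      (by simpa using hlim0.const_add m) (fun n => hm _ (hcC n)) (fun n => (hcm n).le)
  have hnorm : Filter.Tendsto (fun n => ‖(c n).1 - v‖ ^ 2 / 2) Filter.atTop
      (nhds (‖y - v‖ ^ 2 / 2)) := (((hy.sub_const v).norm).pow 2).div_const 2
  have ht : Filter.Tendsto (fun n => (c n).2) Filter.atTop (nhds (m - ‖y - v‖ ^ 2 / 2)) := by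
    refine (hφ.sub hnorm).congr fun n => ?_
    simp only [φ]
    ring
  have hmem : (y, m - ‖y - v‖ ^ 2 / 2) ∈ C :=
    hclosed.mem_of_tendsto (hy.prodMk_nhds ht) (Filter.Eventually.of_forall hcC)
  refine ⟨_, hmem, fun d hd => subgradient_of_isMinOn hconv hmem (fun e he => ?_) hd⟩
  simpa using hm e he

/-- Existence of proximal points of a supremum of continuous affine functions `⟨·, b i⟩ - k i`
which is finite somewhere. The number `t` is its value at `y`. -/
theorem exists_prox_of_affine_family [CompleteSpace H] {ι : Type*} {b : ι → H} {k : ι → ℝ}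
    (i₀ : ι) {y₀ : H} {t₀ : ℝ} (h₀ : ∀ i, inner ℝ y₀ (b i) - k i ≤ t₀) (v : H) :
    ∃ (y : H) (t : ℝ), (∀ i, inner ℝ y (b i) - k i ≤ t) ∧
      ∀ (x : H) (s : ℝ), (∀ i, inner ℝ x (b i) - k i ≤ s) → t + inner ℝ (x - y) (v - y) ≤ s := by
  have hclosed : IsClosed {c : H × ℝ | ∀ i, inner ℝ c.1 (b i) - k i ≤ c.2} := by
    rw [Set.ofPred_forall]
    exact isClosed_iInter fun i => isClosed_le
      ((continuous_fst.inner continuous_const).sub continuous_const) continuous_snd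
  have hconv : Convex ℝ {c : H × ℝ | ∀ i, inner ℝ c.1 (b i) - k i ≤ c.2} := by
    intro c hc d hd r s hr hs hrs i
    have h1 := mul_le_mul_of_nonneg_left (hc i) hr
    have h2 := mul_le_mul_of_nonneg_left (hd i) hs
    simp only [Prod.fst_add, Prod.smul_fst, Prod.snd_add, Prod.smul_snd, smul_eq_mul,
      inner_add_left, real_inner_smul_left]
    have h3 : (r + s) * k i = k i := by rw [hrs, one_mul]
    linarith
  obtain ⟨⟨y, t⟩, hc, hmin⟩ := exists_prox_of_isClosed_convex hclosed hconv ⟨(y₀, t₀), h₀⟩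
    (fun c hc => hc i₀) v
  exact ⟨y, t, hc, fun x s h => hmin (x, s) h⟩

/-- The projector onto a closed convex set, with its variational characterization. -/
theorem exists_projector [CompleteSpace H] {D : Set H} (hne : D.Nonempty) (hclosed : IsClosed D)
    (hconv : Convex ℝ D) :
    ∃ P : H → H, (∀ x, projector D x = {P x}) ∧
      ∀ x, P x ∈ D ∧ ∀ q ∈ D, inner ℝ (x - P x) (q - P x) ≤ 0 := by
  have hex : ∀ x, ∃ p ∈ D, ∀ q ∈ D, inner ℝ (x - p) (q - p) ≤ 0 := by
    intro x
    obtain ⟨p, hp, h⟩ := exists_norm_eq_iInf_of_complete_convex hne hclosed.isComplete hconv x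
    exact ⟨p, hp, (norm_eq_iInf_iff_real_inner_le_zero hconv hp).1 h⟩
  choose P hP hvar using hex
  refine ⟨P, fun x => ?_, fun x => ⟨hP x, hvar x⟩⟩
  have hsq : ∀ q ∈ D, ‖x - P x‖ ^ 2 + ‖q - P x‖ ^ 2 ≤ ‖x - q‖ ^ 2 := by
    intro q hq
    have h := norm_sub_sq_real (x - P x) (q - P x)
    rw [sub_sub_sub_cancel_right] at h
    linarith [hvar x q hq]
  ext p
  refine ⟨fun ⟨hp, hmin⟩ => ?_, ?_⟩
  · have h1 := hsq p hp
    have h2 := pow_le_pow_left₀ (norm_nonneg _) (hmin _ (hP x)) 2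
    have h3 : ‖p - P x‖ = 0 := by nlinarith [norm_nonneg (p - P x)]
    exact sub_eq_zero.1 (norm_eq_zero.1 h3)
  · rintro rfl
    refine ⟨hP x, fun q hq => (sq_le_sq₀ (norm_nonneg _) (norm_nonneg _)).1 ?_⟩
    linarith [hsq q hq, sq_nonneg ‖q - P x‖]

end Hilbert

variable {X : Type*} [NormedAddCommGroup X] [InnerProductSpace ℝ X]

/-! ### The Fitzpatrick function of a monotone operator -/

/-- Monotonicity of a set-valued operator. -/
def IsMonotone (A : X → Set X) : Prop :=
  ∀ p ∈ gra A, ∀ q ∈ gra A, 0 ≤ (inner ℝ (p.1 - q.1) (p.2 - q.2) : ℝ)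

theorem fitzpatrick_le_iff {A : X → Set X} {p : X × X} {t : ℝ} :
    fitzpatrick A p ≤ t ↔
      ∀ a ∈ gra A, inner ℝ p.1 a.2 + inner ℝ a.1 p.2 - inner ℝ a.1 a.2 ≤ t := by
  simp only [fitzpatrick, iSup_le_iff, EReal.coe_le_coe_iff]

theorem le_fitzpatrick {A : X → Set X} {a : X × X} (ha : a ∈ gra A) (p : X × X) :
    ((inner ℝ p.1 a.2 + inner ℝ a.1 p.2 - inner ℝ a.1 a.2 : ℝ) : EReal) ≤ fitzpatrick A p :=
  le_iSup₂_of_le a ha le_rfl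

theorem IsMonotone.fitzpatrick_le {A : X → Set X} (hA : IsMonotone A) {a : X × X}
    (ha : a ∈ gra A) : fitzpatrick A a ≤ ((inner ℝ a.1 a.2 : ℝ) : EReal) := by
  refine fitzpatrick_le_iff.2 fun c hc => ?_
  have h := hA a ha c hc
  simp only [inner_sub_left, inner_sub_right] at h
  linarith

/-- At a point of the graph of `A`, the swapped point satisfies the subgradient inequality of
the Fitzpatrick function, with `⟨a.1, a.2⟩` for the value at `a`. -/
theorem swap_subgradient_fitzpatrick {A : X → Set X} {a : X × X}
    (ha : a ∈ gra A) (p : X × X) :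
    ((inner ℝ a.1 a.2 + pairing (p - a) a.swap : ℝ) : EReal) ≤ fitzpatrick A p := by
  refine le_trans (le_of_eq ?_) (le_fitzpatrick ha p)
  congr 1
  simp only [pairing, Prod.fst_sub, Prod.snd_sub, Prod.fst_swap, Prod.snd_swap, inner_sub_left,
    real_inner_comm a.1 p.2, real_inner_comm a.1 a.2]
  ring

/-- The Fitzpatrick function of a monotone operator with nonempty graph has proximal points. -/
theorem IsMonotone.exists_prox_fitzpatrick [CompleteSpace X] {A : X → Set X} (hA : IsMonotone A)
    (hne : (gra A).Nonempty) (v : X × X) :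
    ∃ (y : X × X) (t : ℝ), fitzpatrick A y ≤ t ∧
      ∀ p : X × X, ((t + pairing (p - y) (v - y) : ℝ) : EReal) ≤ fitzpatrick A p := by
  obtain ⟨a₀, ha₀⟩ := hne
  -- Pass to the `L²` product, which carries the inner product `pairing`.
  have hinner : ∀ (p : WithLp 2 (X × X)) (q : X × X),
      (inner ℝ p (WithLp.toLp 2 q) : ℝ) = pairing (WithLp.ofLp p) q := fun p q =>
    WithLp.prod_inner_apply p (WithLp.toLp 2 q)
  have hepi : ∀ (p : X × X) (t : ℝ), fitzpatrick A p ≤ t ↔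
      ∀ a : gra A, pairing p a.1.swap - inner ℝ a.1.1 a.1.2 ≤ t := by
    intro p t
    rw [fitzpatrick_le_iff, Subtype.forall]
    refine forall₂_congr fun a _ => ?_
    rw [real_inner_comm p.2 a.1]
    exact Iff.rfl
  obtain ⟨y, t, hy, hmin⟩ := exists_prox_of_affine_family (ι := gra A)
    (b := fun a => WithLp.toLp 2 a.1.swap) (k := fun a => inner ℝ a.1.1 a.1.2) ⟨a₀, ha₀⟩
    (y₀ := WithLp.toLp 2 a₀) (t₀ := inner ℝ a₀.1 a₀.2)
    (fun a => by
      rw [hinner]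
      exact (hepi a₀ _).1 (hA.fitzpatrick_le ha₀) a)
    (WithLp.toLp 2 v)
  simp only [hinner] at hy hmin
  refine ⟨WithLp.ofLp y, t, (hepi _ _).2 hy, fun p => ?_⟩
  induction hp : fitzpatrick A p with
  | bot =>
    have := le_fitzpatrick ha₀ p
    rw [hp] at this
    exact absurd this (not_le.2 (EReal.bot_lt_coe _))
  | top => exact le_top
  | coe s =>
    have h := hmin (WithLp.toLp 2 p) s ((hepi p s).1 hp.le)
    exact EReal.coe_le_coe_iff.2 h

/-! ### The proximal average and the operator `Ã` -/

theorem le_conjugate {f : X × X → EReal} {p : X × X} {t : ℝ} (h : f p ≤ t) (q : X × X) :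
    ((pairing p q - t : ℝ) : EReal) ≤ conjugate f q := by
  refine le_iSup_of_le p ?_
  rw [EReal.coe_sub]
  exact EReal.sub_le_sub le_rfl h

/-- One half of the Fenchel–Young equality: at a subgradient `q` of `f` at `p`, the supremum
defining the conjugate is bounded by its value at `p`. -/
theorem conjugate_le_of_subgradient {f : X × X → EReal} {p q : X × X} {t : ℝ}
    (h : ∀ r : X × X, ((t + pairing (r - p) q : ℝ) : EReal) ≤ f r) :
    conjugate f q ≤ ((pairing p q - t : ℝ) : EReal) := by
  refine iSup_le fun r => (EReal.sub_le_sub le_rfl (h r)).trans (le_of_eq ?_)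
  rw [← EReal.coe_sub]
  congr 1
  simp only [pairing, Prod.fst_sub, Prod.snd_sub, inner_sub_left]
  ring

/-- If `v - y` is a subgradient of the Fitzpatrick function at `y`, where `v = (w, w)`, then the
midpoint `p` of `y` and `(v - y).swap` satisfies `p.swap ∈ ∂Ψ p`. The value `R` of `Ψ` at `p` is
part of the conclusion. -/
theorem swap_subgradient_proximalAverage {A : X → Set X} {y : X × X} {t : ℝ} {w : X}
    (hy : fitzpatrick A y ≤ t)
    (hsub : ∀ r : X × X, ((t + pairing (r - y) ((w, w) - y) : ℝ) : EReal) ≤ fitzpatrick A r) :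
    ∃ R : ℝ, proximalAverage A ((1 / 2 : ℝ) • (y + ((w, w) - y).swap)) ≤ R ∧
      ∀ r : X × X, ((R + pairing (r - (1 / 2 : ℝ) • (y + ((w, w) - y).swap))
        ((1 / 2 : ℝ) • (y + ((w, w) - y).swap)).swap : ℝ) : EReal) ≤ proximalAverage A r := by
  have hhalf : (0 : EReal) ≤ ((1 / 2 : ℝ) : EReal) := by exact_mod_cast (by norm_num : (0:ℝ) ≤ 1/2)
  set z : X × X := ((w, w) - y).swap with hz
  have hz1 : z.1 = w - y.2 := rfl
  have hz2 : z.2 = w - y.1 := rfl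
  refine ⟨1 / 2 * t + 1 / 2 * (pairing y ((w, w) - y) - t)
    + 1 / 8 * (‖y.1 - z.1‖ ^ 2 + ‖y.2 - z.2‖ ^ 2), ?_, fun r => ?_⟩
  · refine iInf_le_of_le y (iInf_le_of_le z (iInf_le_of_le rfl ?_))
    have hconj : conjugate (fitzpatrick A) (z.2, z.1) ≤ ((pairing y ((w, w) - y) - t : ℝ) : EReal) :=
      conjugate_le_of_subgradient hsub
    push_cast [EReal.coe_add, EReal.coe_mul] at hconj ⊢
    refine add_le_add (add_le_add ?_ ?_) le_rfl
    · exact mul_le_mul_of_nonneg_left hy hhalf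
    · exact mul_le_mul_of_nonneg_left hconj hhalf
  · refine le_iInf fun y' => le_iInf fun z' => le_iInf fun hr => ?_
    have h1 := mul_le_mul_of_nonneg_left (hsub y') hhalf
    have h2 := mul_le_mul_of_nonneg_left (le_conjugate hy (z'.2, z'.1)) hhalf
    refine le_trans ?_ (add_le_add (add_le_add h1 h2) le_rfl)
    rw [← EReal.coe_mul, ← EReal.coe_mul, ← EReal.coe_add, ← EReal.coe_add, EReal.coe_le_coe_iff,
      hr]
    -- The difference of the two sides is `‖(y' - y) - (z' - z)‖² / 8`.
    have hs1 : 0 ≤ ‖(y'.1 - y.1) - (z'.1 - z.1)‖ ^ 2 := sq_nonneg _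
    have hs2 : 0 ≤ ‖(y'.2 - y.2) - (z'.2 - z.2)‖ ^ 2 := sq_nonneg _
    rw [hz1] at hs1
    rw [hz2] at hs2
    rw [hz1, hz2]
    simp only [pairing, Prod.fst_sub, Prod.snd_sub, Prod.fst_add, Prod.snd_add, Prod.smul_fst,
      Prod.smul_snd, Prod.fst_swap, Prod.snd_swap, hz1, hz2, ← real_inner_self_eq_norm_sq,
      inner_sub_left, inner_sub_right, inner_add_left, inner_add_right, real_inner_smul_left,
      real_inner_smul_right] at hs1 hs2 ⊢
    simp only [real_inner_comm y.1 w, real_inner_comm y.2 w, real_inner_comm y.1 y.2,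
      real_inner_comm y'.1 w, real_inner_comm y'.2 w, real_inner_comm z'.1 w,
      real_inner_comm z'.2 w, real_inner_comm y'.1 y.1, real_inner_comm y'.1 y.2,
      real_inner_comm y'.2 y.1, real_inner_comm y'.2 y.2, real_inner_comm z'.1 y.1,
      real_inner_comm z'.1 y.2, real_inner_comm z'.2 y.1, real_inner_comm z'.2 y.2,
      real_inner_comm z'.1 y'.1, real_inner_comm z'.2 y'.2] at hs1 hs2 ⊢
    linarith

/-- The midpoint of `y` and `((w, w) - y).swap` is in the graph of `Ã`, and its components add up
to `w`. -/
theorem midpoint_mem_tildeOp {A : X → Set X} {y : X × X} {t : ℝ} {w : X}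
    (hy : fitzpatrick A y ≤ t)
    (hsub : ∀ r : X × X, ((t + pairing (r - y) ((w, w) - y) : ℝ) : EReal) ≤ fitzpatrick A r) :
    (1 / 2 : ℝ) • (y + ((w, w) - y).swap) ∈ gra (tildeOp A) := by
  obtain ⟨R, hR, h⟩ := swap_subgradient_proximalAverage hy hsub
  intro r
  refine le_trans (add_le_add hR le_rfl) ?_
  rw [← EReal.coe_add]
  exact h r

theorem midpoint_components_add (y : X × X) (w : X) :
    ((1 / 2 : ℝ) • (y + ((w, w) - y).swap)).1 + ((1 / 2 : ℝ) • (y + ((w, w) - y).swap)).2 = w := by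
  simp only [Prod.smul_fst, Prod.smul_snd, Prod.fst_add, Prod.snd_add, Prod.fst_swap,
    Prod.snd_swap, Prod.fst_sub, Prod.snd_sub]
  module

theorem midpoint_eq_self (a : X × X) :
    (1 / 2 : ℝ) • (a + (((a.1 + a.2, a.1 + a.2) : X × X) - a).swap) = a := by
  ext <;> simp only [Prod.smul_fst, Prod.smul_snd, Prod.fst_add, Prod.snd_add, Prod.fst_swap,
    Prod.snd_swap, Prod.fst_sub, Prod.snd_sub] <;> module

/-- A point of the graph of `A` is its own proximal point for `w = a.1 + a.2`. -/
theorem prox_fitzpatrick_self {A : X → Set X} {a : X × X} (ha : a ∈ gra A) (r : X × X) :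
    ((inner ℝ a.1 a.2 + pairing (r - a) ((a.1 + a.2, a.1 + a.2) - a) : ℝ) : EReal)
      ≤ fitzpatrick A r := by
  have : ((a.1 + a.2, a.1 + a.2) : X × X) - a = a.swap := by ext <;> simp
  rw [this]
  exact swap_subgradient_fitzpatrick ha r

theorem IsMonotone.gra_subset_gra_tildeOp {A : X → Set X} (hA : IsMonotone A) :
    gra A ⊆ gra (tildeOp A) := by
  intro a ha
  have h := midpoint_mem_tildeOp (hA.fitzpatrick_le ha) (prox_fitzpatrick_self ha)
  rwa [midpoint_eq_self] at h

theorem IsMonotone.tildeOp {A : X → Set X} (hA : IsMonotone A) (hne : (gra A).Nonempty) :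
    IsMonotone (tildeOp A) := by
  obtain ⟨a, ha⟩ := hne
  obtain ⟨R, hR, hsub⟩ := swap_subgradient_proximalAverage (hA.fitzpatrick_le ha)
    (prox_fitzpatrick_self ha)
  -- The proximal average is real at each point with a subgradient.
  have hfin : ∀ p ∈ gra (KV.tildeOp A), ∃ s : ℝ, proximalAverage A p = s := by
    intro p hp
    induction h : proximalAverage A p with
    | bot =>
      have := hsub p
      rw [h] at this
      exact absurd this (not_le.2 (EReal.bot_lt_coe _))
    | top =>
      have h1 := (hp ((1 / 2 : ℝ) • (a + (((a.1 + a.2, a.1 + a.2) : X × X) - a).swap))).trans hR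
      have h2 : proximalAverage A (p.1, p.2) = ⊤ := h
      rw [h2, EReal.top_add_coe] at h1
      exact absurd h1 (not_le.2 (EReal.coe_lt_top _))
    | coe s => exact ⟨s, rfl⟩
  intro p hp q hq
  obtain ⟨s, hs⟩ := hfin p hp
  obtain ⟨s', hs'⟩ := hfin q hq
  have h1 := hp q
  have h2 := hq p
  rw [hs', show proximalAverage A (p.1, p.2) = s from hs, ← EReal.coe_add,
    EReal.coe_le_coe_iff] at h1
  rw [hs, show proximalAverage A (q.1, q.2) = s' from hs', ← EReal.coe_add,
    EReal.coe_le_coe_iff] at h2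
  simp only [pairing, Prod.fst_sub, Prod.snd_sub, inner_sub_left, inner_sub_right] at h1 h2 ⊢
  linarith [real_inner_comm p.1 p.2, real_inner_comm p.1 q.2, real_inner_comm q.1 p.2,
    real_inner_comm q.1 q.2]

/-- Minty's surjectivity for `Ã`. -/
theorem IsMonotone.exists_add_eq_of_tildeOp [CompleteSpace X] {A : X → Set X} (hA : IsMonotone A)
    (hne : (gra A).Nonempty) (w : X) : ∃ p ∈ gra (KV.tildeOp A), p.1 + p.2 = w := by
  obtain ⟨y, t, hy, hsub⟩ := hA.exists_prox_fitzpatrick hne (w, w)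
  exact ⟨_, midpoint_mem_tildeOp hy hsub, midpoint_components_add y w⟩

/-! ### The monotone operator of a nonexpansive map -/

theorem mem_gra_associatedOp {S : Set X} {T : S → X} {a : X × X} :
    a ∈ gra (associatedOp T) ↔ ∃ s : S, a = (halfMap T s, (s : X) - halfMap T s) := by
  constructor
  · rintro ⟨s, ⟨hs, h⟩, h'⟩
    exact ⟨⟨s, hs⟩, Prod.ext h.symm (by rw [h]; exact h'.symm)⟩
  · rintro ⟨s, rfl⟩
    exact ⟨s, ⟨s.2, rfl⟩, rfl⟩

theorem isMonotone_associatedOp {S : Set X} {T : S → X}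
    (hT : ∀ x y : S, ‖T x - T y‖ ≤ ‖(x : X) - (y : X)‖) : IsMonotone (associatedOp T) := by
  intro p hp q hq
  obtain ⟨s, rfl⟩ := mem_gra_associatedOp.1 hp
  obtain ⟨t, rfl⟩ := mem_gra_associatedOp.1 hq
  have h1 : halfMap T s - halfMap T t = (1 / 2 : ℝ) • (((s : X) - t) + (T s - T t)) := by
    simp only [halfMap]
    module
  have h2 : ((s : X) - halfMap T s) - (t - halfMap T t)
      = (1 / 2 : ℝ) • (((s : X) - t) - (T s - T t)) := by
    simp only [halfMap]
    module
  have h3 := pow_le_pow_left₀ (norm_nonneg _) (hT s t) 2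
  have h4 : ∀ d e : X, (inner ℝ (d + e) (d - e) : ℝ) = ‖d‖ ^ 2 - ‖e‖ ^ 2 := by
    intro d e
    rw [inner_add_left, inner_sub_right, inner_sub_right, real_inner_self_eq_norm_sq,
      real_inner_self_eq_norm_sq, real_inner_comm d e]
    ring
  rw [h1, h2, real_inner_smul_left, real_inner_smul_right, h4]
  linarith

theorem mem_tildeT {S : Set X} {T : S → X} {x u : X} :
    u ∈ tildeT T x ↔
      ∃ p ∈ gra (KV.tildeOp (associatedOp T)), p.1 + p.2 = x ∧ p.1 - p.2 = u := by
  constructor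
  · rintro ⟨y, ⟨v, hv, rfl⟩, rfl⟩
    refine ⟨(y, v), hv, rfl, ?_⟩
    change y - v = (2 : ℝ) • y - (y + v)
    module
  · rintro ⟨⟨y, v⟩, hv, rfl, rfl⟩
    refine ⟨y, ⟨v, hv, rfl⟩, ?_⟩
    change (2 : ℝ) • y - (y + v) = y - v
    module

/-- The reflected resolvent of a monotone operator is nonexpansive. -/
theorem IsMonotone.norm_reflected_sub_le {B : X → Set X} (hB : IsMonotone B) {p q : X × X}
    (hp : p ∈ gra B) (hq : q ∈ gra B) :
    ‖(p.1 - p.2) - (q.1 - q.2)‖ ≤ ‖(p.1 + p.2) - (q.1 + q.2)‖ := by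
  refine (sq_le_sq₀ (norm_nonneg _) (norm_nonneg _)).1 ?_
  rw [sub_sub_sub_comm, add_sub_add_comm, norm_sub_sq_real, norm_add_sq_real]
  linarith [hB p hp q hq]

end KV

theorem theorem3p6 {X : Type*} [NormedAddCommGroup X] [InnerProductSpace ℝ X] [CompleteSpace X]
    (S : Set X) (hS : S.Nonempty) (T : S → X)
    (hT : ∀ x y : S, ‖T x - T y‖ ≤ ‖(x : X) - (y : X)‖) :
    ∃ Tt P : X → X,
      -- the constructed operator is single-valued with full domain, and so is the projector
      (∀ x, KV.tildeT T x = {Tt x}) ∧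
      (∀ x, KV.projector (closure (convexHull ℝ (Set.range T))) x = {P x}) ∧
      -- the constructed operator is a nonexpansive extension
      (∀ x y, ‖Tt x - Tt y‖ ≤ ‖x - y‖) ∧
      (∀ s : S, Tt s = T s) ∧
      -- so is its composition with the projector, with range closure in the closed convex hull
      (∀ x y, ‖P (Tt x) - P (Tt y)‖ ≤ ‖x - y‖) ∧
      (∀ s : S, P (Tt s) = T s) ∧
      closure (Set.range fun x => P (Tt x)) ⊆ closure (convexHull ℝ (Set.range T)) := by

  have hA := KV.isMonotone_associatedOp hT
  have hne : (KV.gra (KV.associatedOp T)).Nonempty :=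
    let ⟨s, hs⟩ := hS
    ⟨_, KV.mem_gra_associatedOp.2 ⟨⟨s, hs⟩, rfl⟩⟩
  have hB := hA.tildeOp hne
  choose p hp hpx using hA.exists_add_eq_of_tildeOp hne
  have hTt : ∀ x, KV.tildeT T x = {(p x).1 - (p x).2} := by
    intro x
    refine Set.eq_singleton_iff_unique_mem.2
      ⟨KV.mem_tildeT.2 ⟨p x, hp x, hpx x, rfl⟩, fun u hu => ?_⟩
    obtain ⟨q, hq, hqx, rfl⟩ := KV.mem_tildeT.1 hu
    have h := hB.norm_reflected_sub_le hq (hp x)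
    rw [hqx, hpx, sub_self, norm_zero] at h
    exact sub_eq_zero.1 (norm_le_zero_iff.1 h)
  have hext : ∀ s : S, (p s).1 - (p s).2 = T s := by
    intro s
    have hmem : T s ∈ KV.tildeT T s := by
      refine KV.mem_tildeT.2 ⟨_, hA.gra_subset_gra_tildeOp
        (KV.mem_gra_associatedOp.2 ⟨s, rfl⟩), ?_, ?_⟩ <;> simp only [KV.halfMap] <;> module
    rw [hTt] at hmem
    exact hmem.symm
  have hnonexp : ∀ x y, ‖((p x).1 - (p x).2) - ((p y).1 - (p y).2)‖ ≤ ‖x - y‖ := by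
    intro x y
    have h := hB.norm_reflected_sub_le (hp x) (hp y)
    rwa [hpx, hpx] at h
  have hTmem : ∀ s : S, T s ∈ closure (convexHull ℝ (Set.range T)) := fun s =>
    subset_closure (subset_convexHull ℝ _ (Set.mem_range_self s))
  obtain ⟨P, hP, hvar⟩ := KV.exists_projector (D := closure (convexHull ℝ (Set.range T)))
    (let ⟨s, hs⟩ := hS; ⟨_, hTmem ⟨s, hs⟩⟩) isClosed_closure (convex_convexHull ℝ _).closure
  have hPnonexp : ∀ x y, ‖P x - P y‖ ≤ ‖x - y‖ := by
    intro x y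
    have h1 := (hvar x).2 _ (hvar y).1
    have h2 := (hvar y).2 _ (hvar x).1
    have h3 : ‖P x - P y‖ ^ 2 ≤ inner ℝ (x - y) (P x - P y) := by
      rw [← real_inner_self_eq_norm_sq]
      simp only [inner_sub_left, inner_sub_right] at h1 h2 ⊢
      linarith
    have h4 := h3.trans (real_inner_le_norm _ _)
    by_contra! hlt
    nlinarith [norm_nonneg (x - y)]
  refine ⟨fun x => (p x).1 - (p x).2, P, hTt, hP, hnonexp, hext,
    fun x y => (hPnonexp _ _).trans (hnonexp x y), fun s => ?_, ?_⟩
  · have h := (hvar (T s)).2 _ (hTmem s)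
    rw [real_inner_self_nonpos, sub_eq_zero] at h
    simp only [hext]
    exact h.symm
  · refine closure_minimal ?_ isClosed_closure
    rintro _ ⟨x, rfl⟩
    exact (hvar _).1
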